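/- Let $\mathcal C$ be a regular category: it has finite limits, every kernel pair in $\mathcal C$ has a coequalizer, and regular epimorphisms are stable under pullback. Let $\mathbb{R}\mathbf{el}(\mathcal C)$ be the virtual double category of internal relations in $\mathcal C$: its vertical category is $\mathcal C$, a proarrow $R\colon a\nrightarrow b$ is a monomorphism $R\hookrightarrow b\times a$, and a 2-cell $R_1,\dots,R_n\to S$ ($n\ge 0$) with left frame $f\colon c_0\to c$ and right frame $g\colon c_n\to d$ is a morphism $R_1\times_{c_1}\cdots\times_{c_{n-1}}R_n\to S$ forming a commutative square with $g\times f\colon c_n\times c_0\to d\times c$ (for $n=0$ the source is $c_0$). Its units are the diagonals and its restrictions are given by pullback along $g\times f$, so it is a virtual equipment. Terminology, in a virtual equipment. An embedding of a monoid $M\colon c\nrightarrow c$ into an object $x$ is a monoid homomorphism $(f,\vec f\,)$ from $M$ to the trivial monoid (the unit proarrow $U_x$) on $x$; an embedding of an $(M,N)$-bimodule $B$ into a proarrow $P\colon x\nrightarrow y$ over embeddings $f\colon M\to x$, $g\colon N\to y$ is a bimodule homomorphism $B\to P$ over $f$ and $g$, where $P$ is regarded as a bimodule between trivial monoids. A collapse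 of $M$ is a universal embedding of $M$ into an object; a collapse of $B$ is an embedding of $B$ over collapses of $M$ and $N$ through which every embedding of $B$ into a proarrow factors uniquely. A collapse $(i,\vec\imath\,)\colon M\to x$ is normal if $\vec\imath\colon M\to U_x$ is also a collapse of the $(M,M)$-bimodule $M$. A monoid $M$ is a kernel of $f\colon c\to d$ if there is an embedding $(f,\vec f\,)\colon M\to d$ with $\vec f$ a cartesian cell; $M$ is effective if it is a kernel of some vertical arrow; $f$ is a regular cover if this cell $\vec f$ is a normal collapse. A virtual equipment is regular if (1) every effective monoid has a normal collapse, and (2) for every proarrow $B\colon d\nrightarrow d'$ and all regular covers $f\colon c\to d$ and $g\colon c'\to d'$, the cartesian embedding $B(g,f)\to B$ of the $(\ker f,\ker g)$-bimodule $B(g,f)$ is a bimodule collapse. Then: 1. $\mathbb{R}\mathbf{el}(\mathcal C)$ has all composites of proarrows (so it is an equipment), and it is a regular virtual equipment. 2. Every morphism $f$ of $\mathcal C$ has a kernel in $\mathbb{R}\mathbf{el}(\mathcal C)$, and a monoid $M\hookrightarrow a\times a$ in $\mathbb{R}\mathbf{el}(\mathcal C)$ is a kernel of $f\colon a\to b$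 if and only if its two projections $M\rightrightarrows a$ form a kernel pair of $f$ in $\mathcal C$. In particular, the effective monoids are exactly the monoids given by kernel pairs. 3. If $M\hookrightarrow a\times a$ is an effective monoid and $q\colon a\to x$ is a coequalizer in $\mathcal C$ of its two projections $M\rightrightarrows a$, then $q$ underlies a normal collapse of $M$. -/

import Mathlib

open CategoryTheory CategoryTheory.Limits

universe w w' v u

set_option linter.checkUnivs false

/-! ### Virtual double categories -/

/-- Composable strings `A₁, …, Aₙ` (`n ≥ 0`) of proarrows. -/
inductive ProPath {D : Type u} (H : D → D → Type w) : D → D → Type (max u w)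
  | nil (a : D) : ProPath H a a
  | cons {a b c : D} (A : H a b) (P : ProPath H b c) : ProPath H a c

namespace ProPath

variable {D : Type u} {H : D → D → Type w}

/-- Concatenation of strings of proarrows. -/
def append {a b c : D} : ProPath H a b → ProPath H b c → ProPath H a c
  | nil _, Q => Q
  | cons A P, Q => cons A (P.append Q)

/-- The string consisting of one proarrow. -/
abbrev single {a b : D} (A : H a b) : ProPath H a b := cons A (nil b)

/-- The string consisting of two proarrows. -/
abbrev pair {a b c : D} (A : H a b) (B : H b c) : ProPath H a c := cons A (single B)

theorem append_nil {a b : D} (P : ProPath H a b) : P.append (nil b) = P := by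
  induction P with
  | nil => rfl
  | cons A P ih => simp only [append, ih]

theorem append_assoc {a b c d : D} (P : ProPath H a b) (Q : ProPath H b c) (R : ProPath H c d) :
    (P.append Q).append R = P.append (Q.append R) := by
  induction P with
  | nil => rfl
  | cons A P ih => simp only [append, ih]

end ProPath

/-- The proarrows and the cells of a virtual double category with vertical category `D`, before
identities and composition. `Cell P f g B` is the set of cells with multi-source the string `P`,
left frame `f`, right frame `g` and target `B`. -/
structure VirtualDoubleGraph (D : Type u) [Category.{v} D] where
  Pro : D → D → Type w
  Cell : {a b c d : D} → ProPath Pro a b → (a ⟶ c) → (b ⟶ d) → Pro c d → Type w'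

/-- Horizontally composable strings of cells `ψ₁, …, ψₙ`: the target of `ψᵢ` is the `i`-th member
of the string `P`, the right frame of each `ψᵢ` is the left frame of the next one, and `Q` is the
concatenation of the multi-sources of the `ψᵢ`. The outermost frames are `h` and `k`. -/
inductive CellPath {D : Type u} [Category.{v} D] (G : VirtualDoubleGraph.{w, w'} D) :
    {a b c d : D} → ProPath G.Pro a b → ProPath G.Pro c d → (a ⟶ c) → (b ⟶ d) →
      Type (max u v w w')
  | nil {a c : D} (h : a ⟶ c) : CellPath G (.nil a) (.nil c) h h
  | cons {a b e c d i : D} {R : ProPath G.Pro a e} {Q : ProPath G.Pro a b}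
      {Q' : ProPath G.Pro b e} {A : G.Pro c d} {P : ProPath G.Pro d i}
      {h : a ⟶ c} {k : b ⟶ d} {l : e ⟶ i} (ψ : G.Cell Q h k A) (Ψ : CellPath G Q' P k l)
      (hR : R = Q.append Q') : CellPath G R (.cons A P) h l

namespace CellPath

variable {D : Type u} [Category.{v} D] {G : VirtualDoubleGraph.{w, w'} D}

/-- The string consisting of one cell. -/
def single {a b c d : D} {Q : ProPath G.Pro a b} {A : G.Pro c d} {h : a ⟶ c} {k : b ⟶ d}
    (ψ : G.Cell Q h k A) : CellPath G Q (.single A) h k :=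
  cons ψ (nil k) Q.append_nil.symm

/-- The string consisting of two cells. -/
def pair {a b e c d i : D} {Q : ProPath G.Pro a b} {Q' : ProPath G.Pro b e} {A : G.Pro c d}
    {B : G.Pro d i} {h : a ⟶ c} {k : b ⟶ d} {l : e ⟶ i} (ψ : G.Cell Q h k A)
    (ψ' : G.Cell Q' k l B) : CellPath G (Q.append Q') (.pair A B) h l :=
  cons ψ (single ψ') rfl

/-- Concatenation of strings of cells. -/
def append {a b c d : D} {Q : ProPath G.Pro a b} {P : ProPath G.Pro c d} {h : a ⟶ c} {k : b ⟶ d} :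
    {e i : D} → {Q' : ProPath G.Pro b e} → {P' : ProPath G.Pro d i} → {l : e ⟶ i} →
    CellPath G Q P h k → CellPath G Q' P' k l → CellPath G (Q.append Q') (P.append P') h l
  | _, _, _, _, _, nil _, Ψ' => Ψ'
  | _, _, Q', _, _, cons (Q := Q₁) (Q' := Q₂) ψ Ψ hR, Ψ' =>
      cons ψ (Ψ.append Ψ') (by rw [hR, ProPath.append_assoc])

/-- The string of identity cells of a string of proarrows. -/
def ids (i : ∀ {a b : D} (A : G.Pro a b), G.Cell (.single A) (𝟙 a) (𝟙 b) A) :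
    {a b : D} → (P : ProPath G.Pro a b) → CellPath G P P (𝟙 a) (𝟙 b)
  | _, _, .nil a => nil (𝟙 a)
  | _, _, .cons A P => cons (i A) (ids i P) rfl

/-- `IsVComp @comp Θ Ψ Ξ`: the string `Ψ` is `ψ₁, …, ψₙ`, the string `Θ` is the concatenation of
strings `Θ₁, …, Θₙ`, where the targets of `Θᵢ` form the multi-source of `ψᵢ`, and `Ξ` is
the string of the composites of `Θᵢ` with `ψᵢ`. -/
inductive IsVComp
    (comp : ∀ {a b c d x y : D} {Q : ProPath G.Pro a b} {P : ProPath G.Pro c d} {B : G.Pro x y}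
      {h : a ⟶ c} {k : b ⟶ d} {f : c ⟶ x} {g : d ⟶ y} {f' : a ⟶ x} {g' : b ⟶ y},
      CellPath G Q P h k → G.Cell P f g B → h ≫ f = f' → k ≫ g = g' → G.Cell Q f' g' B) :
    ∀ {a b c d x y : D} {R : ProPath G.Pro a b} {Q : ProPath G.Pro c d} {P : ProPath G.Pro x y}
      {h : a ⟶ c} {k : b ⟶ d} {f : c ⟶ x} {g : d ⟶ y} {f' : a ⟶ x} {g' : b ⟶ y},
      CellPath G R Q h k → CellPath G Q P f g → CellPath G R P f' g' → Prop
  | nil {a b c : D} (h : a ⟶ b) (f : b ⟶ c) (f' : a ⟶ c) (hf : h ≫ f = f') :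
      IsVComp @comp (nil h) (nil f) (nil f')
  | cons {a b e c d i x y z : D} {R₁ : ProPath G.Pro a b} {R₂ : ProPath G.Pro b e}
      {Q₁ : ProPath G.Pro c d} {Q₂ : ProPath G.Pro d i} {A : G.Pro x y} {P : ProPath G.Pro y z}
      {h : a ⟶ c} {k : b ⟶ d} {l : e ⟶ i} {f : c ⟶ x} {g : d ⟶ y} {j : i ⟶ z}
      {f' : a ⟶ x} {g' : b ⟶ y} {j' : e ⟶ z}
      (Θ₁ : CellPath G R₁ Q₁ h k) (Θ₂ : CellPath G R₂ Q₂ k l)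
      (ψ : G.Cell Q₁ f g A) (Ψ : CellPath G Q₂ P g j) (Ξ : CellPath G R₂ P g' j')
      (hf : h ≫ f = f') (hg : k ≫ g = g') (H : IsVComp @comp Θ₂ Ψ Ξ) :
      IsVComp @comp (Θ₁.append Θ₂) (cons ψ Ψ rfl) (cons (comp Θ₁ ψ hf hg) Ξ rfl)

theorem cons_heq {a b e c d i : D} {R R' : ProPath G.Pro a e} {Q : ProPath G.Pro a b}
    {Q' Q'' : ProPath G.Pro b e} {A : G.Pro c d} {P P' : ProPath G.Pro d i}
    {h : a ⟶ c} {k : b ⟶ d} {l : e ⟶ i} (ψ : G.Cell Q h k A) (Ψ : CellPath G Q' P k l)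
    (Ψ' : CellPath G Q'' P' k l) (hR : R = Q.append Q') (hR' : R' = Q.append Q'')
    (hQ : Q' = Q'') (hP : P = P') (hΨ : HEq Ψ Ψ') : HEq (cons ψ Ψ hR) (cons ψ Ψ' hR') := by
  subst hR hR' hQ hP hΨ
  rfl

theorem append_nil_heq {a b c d : D} {Q : ProPath G.Pro a b} {P : ProPath G.Pro c d} {h : a ⟶ c}
    {k : b ⟶ d} (Ψ : CellPath G Q P h k) : HEq (Ψ.append (nil k)) Ψ := by
  induction Ψ with
  | nil h => rfl
  | cons ψ Ψ hR ih => exact cons_heq _ _ _ _ _ (ProPath.append_nil _) (ProPath.append_nil _) ih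

end CellPath

/-- A virtual double category with vertical category `D`. The composite of a string of cells
`Ψ` with a cell `φ` has left frame `h ≫ f` and right frame `k ≫ g`; in `comp` these frames may be
given by any arrows `f'`, `g'` equal to them, so that the laws are equations in one set of
cells. -/
structure VirtualDoubleCategory (D : Type u) [Category.{v} D] extends
    VirtualDoubleGraph.{w, w'} D where
  idCell : ∀ {a b : D} (A : Pro a b), Cell (.single A) (𝟙 a) (𝟙 b) A
  comp : ∀ {a b c d x y : D} {Q : ProPath Pro a b} {P : ProPath Pro c d} {B : Pro x y}
    {h : a ⟶ c} {k : b ⟶ d} {f : c ⟶ x} {g : d ⟶ y} {f' : a ⟶ x} {g' : b ⟶ y},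
    CellPath toVirtualDoubleGraph Q P h k → Cell P f g B → h ≫ f = f' → k ≫ g = g' →
      Cell Q f' g' B
  ids_comp : ∀ {a b c d : D} {P : ProPath Pro a b} {B : Pro c d} {f : a ⟶ c} {g : b ⟶ d}
    (φ : Cell P f g B),
    comp (CellPath.ids idCell P) φ (Category.id_comp f) (Category.id_comp g) = φ
  comp_id : ∀ {a b c d : D} {P : ProPath Pro a b} {B : Pro c d} {f : a ⟶ c} {g : b ⟶ d}
    (φ : Cell P f g B),
    comp (CellPath.single φ) (idCell B) (Category.comp_id f) (Category.comp_id g) = φ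
  assoc : ∀ {a b c d p q x y : D} {R : ProPath Pro a b} {Q : ProPath Pro c d}
    {P : ProPath Pro p q} {B : Pro x y} {h : a ⟶ c} {k : b ⟶ d} {f : c ⟶ p} {g : d ⟶ q}
    {hf : a ⟶ p} {kg : b ⟶ q} {r : p ⟶ x} {s : q ⟶ y} {fr : c ⟶ x} {gs : d ⟶ y}
    {t : a ⟶ x} {t' : b ⟶ y}
    (Θ : CellPath toVirtualDoubleGraph R Q h k) (Ψ : CellPath toVirtualDoubleGraph Q P f g)
    (Ξ : CellPath toVirtualDoubleGraph R P hf kg) (φ : Cell P r s B)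
    (e₁ : f ≫ r = fr) (e₂ : g ≫ s = gs) (e₃ : h ≫ fr = t) (e₄ : k ≫ gs = t')
    (e₅ : hf ≫ r = t) (e₆ : kg ≫ s = t'),
    CellPath.IsVComp @comp Θ Ψ Ξ → comp Θ (comp Ψ φ e₁ e₂) e₃ e₄ = comp Ξ φ e₅ e₆

namespace VirtualDoubleCategory

variable {D : Type u} [Category.{v} D] (𝔻 : VirtualDoubleCategory.{w, w'} D)

/-- Strings of proarrows of `𝔻`. -/
abbrev Path (a b : D) := ProPath 𝔻.Pro a b

/-- Strings of cells of `𝔻`. -/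
abbrev Cells {a b c d : D} (Q : 𝔻.Path a b) (P : 𝔻.Path c d) (h : a ⟶ c) (k : b ⟶ d) :=
  CellPath 𝔻.toVirtualDoubleGraph Q P h k

variable {𝔻}

/-- The string of identity cells of a string of proarrows. -/
abbrev idCells {a b : D} (P : 𝔻.Path a b) : 𝔻.Cells P P (𝟙 a) (𝟙 b) :=
  CellPath.ids 𝔻.idCell P

/-- The composite of a string of cells with a cell, for cells with identity frames. -/
abbrev gcomp {a b : D} {Q P : 𝔻.Path a b} {B : 𝔻.Pro a b} (Ψ : 𝔻.Cells Q P (𝟙 a) (𝟙 b))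
    (φ : 𝔻.Cell P (𝟙 a) (𝟙 b) B) : 𝔻.Cell Q (𝟙 a) (𝟙 b) B :=
  𝔻.comp Ψ φ (Category.comp_id _) (Category.comp_id _)

theorem isVComp_single {a b c d x y : D} {R : 𝔻.Path a b} {Q : 𝔻.Path c d} {A : 𝔻.Pro x y}
    {h : a ⟶ c} {k : b ⟶ d} {f : c ⟶ x} {g : d ⟶ y} {f' : a ⟶ x} {g' : b ⟶ y}
    (Θ : 𝔻.Cells R Q h k) (ψ : 𝔻.Cell Q f g A) (hf : h ≫ f = f') (hg : k ≫ g = g') :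
    CellPath.IsVComp 𝔻.comp Θ (.single ψ) (.single (𝔻.comp Θ ψ hf hg)) := by
  have key : ∀ {R' : 𝔻.Path a b} {Q' : 𝔻.Path c d} (Θ' : 𝔻.Cells R' Q' h k)
      (Ψ : 𝔻.Cells Q' (.single A) f g) (Ξ : 𝔻.Cells R' (.single A) f' g'),
      R' = R → Q' = Q → HEq Θ' Θ → HEq Ψ (CellPath.single ψ) →
      HEq Ξ (CellPath.single (𝔻.comp Θ ψ hf hg)) → CellPath.IsVComp 𝔻.comp Θ' Ψ Ξ →
      CellPath.IsVComp 𝔻.comp Θ (.single ψ) (.single (𝔻.comp Θ ψ hf hg)) := by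
    rintro R' Q' Θ' Ψ Ξ rfl rfl hΘ hΨ hΞ H
    cases hΘ
    cases hΨ
    cases hΞ
    exact H
  refine key _ _ _ (ProPath.append_nil _) (ProPath.append_nil _) (CellPath.append_nil_heq Θ) ?_ ?_
    (CellPath.IsVComp.cons Θ (.nil k) ψ (.nil g) (.nil g') hf hg (.nil k g g' hg))
  · exact CellPath.cons_heq _ _ _ _ _ rfl rfl HEq.rfl
  · exact CellPath.cons_heq _ _ _ _ _ rfl rfl HEq.rfl

theorem gassoc_single {a b : D} {R Q : 𝔻.Path a b} {A B : 𝔻.Pro a b}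
    (Θ : 𝔻.Cells R Q (𝟙 a) (𝟙 b)) (ψ : 𝔻.Cell Q (𝟙 a) (𝟙 b) A)
    (φ : 𝔻.Cell (.single A) (𝟙 a) (𝟙 b) B) :
    gcomp Θ (gcomp (.single ψ) φ) = gcomp (.single (gcomp Θ ψ)) φ :=
  𝔻.assoc _ _ _ _ _ _ _ _ _ _ (isVComp_single _ _ _ _)

theorem gassoc_pair {a b c : D} {R₁ Q₁ : 𝔻.Path a b} {R₂ Q₂ : 𝔻.Path b c} {A : 𝔻.Pro a b}
    {B : 𝔻.Pro b c} {C : 𝔻.Pro a c} (Θ₁ : 𝔻.Cells R₁ Q₁ (𝟙 a) (𝟙 b))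
    (Θ₂ : 𝔻.Cells R₂ Q₂ (𝟙 b) (𝟙 c)) (ψ₁ : 𝔻.Cell Q₁ (𝟙 a) (𝟙 b) A)
    (ψ₂ : 𝔻.Cell Q₂ (𝟙 b) (𝟙 c) B) (φ : 𝔻.Cell (.pair A B) (𝟙 a) (𝟙 c) C) :
    gcomp (Θ₁.append Θ₂) (gcomp (.pair ψ₁ ψ₂) φ) =
      gcomp (.pair (gcomp Θ₁ ψ₁) (gcomp Θ₂ ψ₂)) φ :=
  𝔻.assoc _ _ _ _ _ _ _ _ _ _
    (CellPath.IsVComp.cons Θ₁ Θ₂ ψ₁ _ _ _ _ (isVComp_single _ _ _ _))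

theorem gcomp_ids {a b : D} {P : 𝔻.Path a b} {B : 𝔻.Pro a b} (φ : 𝔻.Cell P (𝟙 a) (𝟙 b) B) :
    gcomp (idCells P) φ = φ :=
  𝔻.ids_comp φ

theorem gcomp_idCell {a b : D} {P : 𝔻.Path a b} {B : 𝔻.Pro a b} (φ : 𝔻.Cell P (𝟙 a) (𝟙 b) B) :
    gcomp (.single φ) (𝔻.idCell B) = φ :=
  𝔻.comp_id φ

/-- A cell `φ : P₁, …, Pₙ → Q` with identity frames is opcartesian if composition with it is a
bijection from the cells `R₁, …, Rₘ, Q, S₁, …, Sₖ → T` to the cells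
`R₁, …, Rₘ, P₁, …, Pₙ, S₁, …, Sₖ → T`, for all frames. -/
def IsOpcartesian {c d : D} {P : 𝔻.Path c d} {Q : 𝔻.Pro c d}
    (φ : 𝔻.Cell P (𝟙 c) (𝟙 d) Q) : Prop :=
  ∀ {a b x y : D} (R : 𝔻.Path a c) (S : 𝔻.Path d b) (f : a ⟶ x) (g : b ⟶ y) (T : 𝔻.Pro x y),
    Function.Bijective (fun ψ : 𝔻.Cell (R.append (.cons Q S)) f g T =>
      (𝔻.comp ((idCells R).append (.cons φ (idCells S) rfl)) ψ (Category.id_comp f)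
        (Category.id_comp g) : 𝔻.Cell (R.append (P.append S)) f g T))

/-- A cell `φ : P → Q` with frames `f` and `g` is cartesian if composition with it is a bijection
from the cells `R₁, …, Rₙ → P` with frames `h`, `k` to the cells `R₁, …, Rₙ → Q` with frames
`h ≫ f`, `k ≫ g`. -/
def IsCartesian {a b c d : D} {P : 𝔻.Pro a b} {Q : 𝔻.Pro c d} {f : a ⟶ c} {g : b ⟶ d}
    (φ : 𝔻.Cell (.single P) f g Q) : Prop :=
  ∀ {x y : D} (R : 𝔻.Path x y) (h : x ⟶ a) (k : y ⟶ b),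
    Function.Bijective (fun ψ : 𝔻.Cell R h k P =>
      (𝔻.comp (.single ψ) φ rfl rfl : 𝔻.Cell R (h ≫ f) (k ≫ g) Q))

variable (𝔻)

/-- Every string of `n ≥ 0` composable proarrows has a composite. -/
def HasComposites : Prop :=
  ∀ {a b : D} (P : 𝔻.Path a b), ∃ (Q : 𝔻.Pro a b) (φ : 𝔻.Cell P (𝟙 a) (𝟙 b) Q), IsOpcartesian φ

/-- All restrictions exist. -/
def HasRestrictions : Prop :=
  ∀ {a b c d : D} (f : a ⟶ c) (g : b ⟶ d) (Q : 𝔻.Pro c d),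
    ∃ (P : 𝔻.Pro a b) (φ : 𝔻.Cell (.single P) f g Q), IsCartesian φ

/-- A monoid in a virtual double category. -/
structure VMonoid (c : D) where
  pro : 𝔻.Pro c c
  e : 𝔻.Cell (.nil c) (𝟙 c) (𝟙 c) pro
  m : 𝔻.Cell (.pair pro pro) (𝟙 c) (𝟙 c) pro
  unit_mul : gcomp (.pair e (𝔻.idCell pro)) m = 𝔻.idCell pro
  mul_unit : gcomp (.pair (𝔻.idCell pro) e) m = 𝔻.idCell pro
  mul_assoc : gcomp (.pair m (𝔻.idCell pro)) m = gcomp (.pair (𝔻.idCell pro) m) m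

variable {𝔻}

/-- A monoid homomorphism. -/
@[ext] structure VMonoidHom {c d : D} (M : 𝔻.VMonoid c) (N : 𝔻.VMonoid d) where
  hom : c ⟶ d
  cell : 𝔻.Cell (.single M.pro) hom hom N.pro
  unit : 𝔻.comp (.single M.e) cell (Category.id_comp hom) (Category.id_comp hom) =
    𝔻.comp (.nil hom) N.e (Category.comp_id hom) (Category.comp_id hom)
  mul : 𝔻.comp (.single M.m) cell (Category.id_comp hom) (Category.id_comp hom) =
    𝔻.comp (.pair cell cell) N.m (Category.comp_id hom) (Category.comp_id hom)

/-- An `(M, N)`-bimodule. -/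
structure VBimodule {c d : D} (M : 𝔻.VMonoid c) (N : 𝔻.VMonoid d) where
  pro : 𝔻.Pro c d
  l : 𝔻.Cell (.pair M.pro pro) (𝟙 c) (𝟙 d) pro
  r : 𝔻.Cell (.pair pro N.pro) (𝟙 c) (𝟙 d) pro
  unit_l : gcomp (.pair M.e (𝔻.idCell pro)) l = 𝔻.idCell pro
  mul_l : gcomp (.pair M.m (𝔻.idCell pro)) l = gcomp (.pair (𝔻.idCell M.pro) l) l
  unit_r : gcomp (.pair (𝔻.idCell pro) N.e) r = 𝔻.idCell pro
  mul_r : gcomp (.pair (𝔻.idCell pro) N.m) r = gcomp (.pair r (𝔻.idCell N.pro)) r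
  l_r : gcomp (.pair l (𝔻.idCell N.pro)) r = gcomp (.pair (𝔻.idCell M.pro) r) l

/-- The unit `(M, M)`-bimodule: `M` acting on itself on both sides. -/
def VMonoid.unitBimodule {c : D} (M : 𝔻.VMonoid c) : VBimodule M M where
  pro := M.pro
  l := M.m
  r := M.m
  unit_l := M.unit_mul
  mul_l := M.mul_assoc
  unit_r := M.mul_unit
  mul_r := M.mul_assoc.symm
  l_r := M.mul_assoc

/-- The cell `φ : B → B'` whose frames are the vertical arrows of the monoid homomorphisms `F`
and `G` is a bimodule homomorphism over `F` and `G`. -/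
structure IsBimoduleHom {c d c' d' : D} {M : 𝔻.VMonoid c} {N : 𝔻.VMonoid d} {M' : 𝔻.VMonoid c'} {N' : 𝔻.VMonoid d'}
    (F : VMonoidHom M M') (G : VMonoidHom N N') (B : VBimodule M N) (B' : VBimodule M' N')
    (φ : 𝔻.Cell (.single B.pro) F.hom G.hom B'.pro) : Prop where
  left : 𝔻.comp (.single B.l) φ (Category.id_comp _) (Category.id_comp _) =
    𝔻.comp (.pair F.cell φ) B'.l (Category.comp_id _) (Category.comp_id _)
  right : 𝔻.comp (.single B.r) φ (Category.id_comp _) (Category.id_comp _) =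
    𝔻.comp (.pair φ G.cell) B'.r (Category.comp_id _) (Category.comp_id _)

end VirtualDoubleCategory

/-! ### Virtual equipments -/

open VirtualDoubleCategory

/-- A virtual equipment: a virtual double category with (chosen) units and with restrictions. -/
structure VirtualEquipment (D : Type u) [Category.{v} D] extends
    VirtualDoubleCategory.{w, w'} D where
  U : ∀ c : D, Pro c c
  η : ∀ c : D, Cell (.nil c) (𝟙 c) (𝟙 c) (U c)
  η_opcartesian : ∀ c : D, toVirtualDoubleCategory.IsOpcartesian (η c)
  hasRestrictions : toVirtualDoubleCategory.HasRestrictions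

namespace VirtualEquipment

variable {D : Type u} [Category.{v} D] (𝔼 : VirtualEquipment.{w, w'} D)

/-- The canonical cell `U, P → P`. -/
noncomputable def lam {a b : D} (P : 𝔼.Pro a b) : 𝔼.Cell (.pair (𝔼.U a) P) (𝟙 a) (𝟙 b) P :=
  ((𝔼.η_opcartesian a (.nil a) (.single P) (𝟙 a) (𝟙 b) P).2 (𝔼.idCell P)).choose

theorem lam_spec {a b : D} (P : 𝔼.Pro a b) :
    gcomp (.pair (𝔼.η a) (𝔼.idCell P)) (𝔼.lam P) = 𝔼.idCell P :=
  ((𝔼.η_opcartesian a (.nil a) (.single P) (𝟙 a) (𝟙 b) P).2 (𝔼.idCell P)).choose_spec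

/-- The canonical cell `P, U → P`. -/
noncomputable def rho {a b : D} (P : 𝔼.Pro a b) : 𝔼.Cell (.pair P (𝔼.U b)) (𝟙 a) (𝟙 b) P :=
  ((𝔼.η_opcartesian b (.single P) (.nil b) (𝟙 a) (𝟙 b) P).2 (𝔼.idCell P)).choose

theorem rho_spec {a b : D} (P : 𝔼.Pro a b) :
    gcomp (.pair (𝔼.idCell P) (𝔼.η b)) (𝔼.rho P) = 𝔼.idCell P :=
  ((𝔼.η_opcartesian b (.single P) (.nil b) (𝟙 a) (𝟙 b) P).2 (𝔼.idCell P)).choose_spec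

/-- The unit cell on a vertical arrow. -/
noncomputable def unitCell {c d : D} (f : c ⟶ d) : 𝔼.Cell (.single (𝔼.U c)) f f (𝔼.U d) :=
  ((𝔼.η_opcartesian c (.nil c) (.nil c) f f (𝔼.U d)).2
    (𝔼.comp (.nil f) (𝔼.η d) (Category.comp_id f) (Category.comp_id f))).choose

theorem unitCell_spec {c d : D} (f : c ⟶ d) :
    𝔼.comp (.single (𝔼.η c)) (𝔼.unitCell f) (Category.id_comp f) (Category.id_comp f) =
      𝔼.comp (.nil f) (𝔼.η d) (Category.comp_id f) (Category.comp_id f) :=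
  ((𝔼.η_opcartesian c (.nil c) (.nil c) f f (𝔼.U d)).2
    (𝔼.comp (.nil f) (𝔼.η d) (Category.comp_id f) (Category.comp_id f))).choose_spec

variable {𝔼} in
theorem eta_cancel {a b : D} {S : 𝔼.Path a b} {T : 𝔼.Pro a b}
    {φ ψ : 𝔼.Cell (.cons (𝔼.U a) S) (𝟙 a) (𝟙 b) T}
    (h : gcomp ((CellPath.single (𝔼.η a)).append (idCells S)) φ =
      gcomp ((CellPath.single (𝔼.η a)).append (idCells S)) ψ) : φ = ψ :=
  (𝔼.η_opcartesian a (.nil a) S (𝟙 a) (𝟙 b) T).1 h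

variable {𝔼} in
theorem eta_cancel_right {a b c : D} {P : 𝔼.Pro a b} {Q : 𝔼.Pro b c} {T : 𝔼.Pro a c}
    {φ ψ : 𝔼.Cell (.cons P (.pair Q (𝔼.U c))) (𝟙 a) (𝟙 c) T}
    (h : gcomp ((idCells (.pair P Q)).append (CellPath.single (𝔼.η c))) φ =
      gcomp ((idCells (.pair P Q)).append (CellPath.single (𝔼.η c))) ψ) : φ = ψ :=
  (𝔼.η_opcartesian c (.pair P Q) (.nil c) (𝟙 a) (𝟙 c) T).1 h

theorem eta_lam {a b : D} {S : 𝔼.Path a b} {P : 𝔼.Pro a b} (φ : 𝔼.Cell S (𝟙 a) (𝟙 b) P) :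
    gcomp (.pair (𝔼.η a) φ) (𝔼.lam P) = φ := by
  have h := gassoc_pair (CellPath.nil (𝟙 a)) (.single φ) (𝔼.η a) (𝔼.idCell P) (𝔼.lam P)
  rw [lam_spec, gcomp_idCell] at h
  have h' : gcomp (CellPath.nil (𝟙 a)) (𝔼.η a) = 𝔼.η a := gcomp_ids (𝔼.η a)
  rw [h'] at h
  exact h.symm.trans (gcomp_idCell φ)

theorem lam_lam {a b : D} (P : 𝔼.Pro a b) :
    gcomp (.pair (𝔼.lam (𝔼.U a)) (𝔼.idCell P)) (𝔼.lam P) =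
      gcomp (.pair (𝔼.idCell (𝔼.U a)) (𝔼.lam P)) (𝔼.lam P) := by
  apply eta_cancel
  have h₁ := gassoc_pair (.pair (𝔼.η a) (𝔼.idCell (𝔼.U a))) (.single (𝔼.idCell P))
    (𝔼.lam (𝔼.U a)) (𝔼.idCell P) (𝔼.lam P)
  rw [lam_spec, gcomp_idCell] at h₁
  have h₂ := gassoc_pair (.single (𝔼.η a)) (idCells (.pair (𝔼.U a) P))
    (𝔼.idCell (𝔼.U a)) (𝔼.lam P) (𝔼.lam P)
  rw [gcomp_idCell, gcomp_ids, eta_lam] at h₂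
  exact (h₁.trans (gcomp_ids (𝔼.lam P))).trans h₂.symm

theorem lam_unit (a : D) :
    gcomp (.pair (𝔼.idCell (𝔼.U a)) (𝔼.η a)) (𝔼.lam (𝔼.U a)) = 𝔼.idCell (𝔼.U a) := by
  apply eta_cancel
  have h := gassoc_pair (.single (𝔼.η a)) (.nil (𝟙 a)) (𝔼.idCell (𝔼.U a)) (𝔼.η a)
    (𝔼.lam (𝔼.U a))
  have h' : gcomp (CellPath.nil (𝟙 a)) (𝔼.η a) = 𝔼.η a := gcomp_ids (𝔼.η a)
  rw [gcomp_idCell, h', eta_lam] at h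
  exact h.trans (gcomp_idCell (𝔼.η a)).symm

theorem rho_rho {a b : D} (P : 𝔼.Pro a b) :
    gcomp (.pair (𝔼.idCell P) (𝔼.lam (𝔼.U b))) (𝔼.rho P) =
      gcomp (.pair (𝔼.rho P) (𝔼.idCell (𝔼.U b))) (𝔼.rho P) := by
  apply eta_cancel_right
  have h₁ := gassoc_pair (.single (𝔼.idCell P)) (.pair (𝔼.idCell (𝔼.U b)) (𝔼.η b))
    (𝔼.idCell P) (𝔼.lam (𝔼.U b)) (𝔼.rho P)
  rw [lam_unit, gcomp_idCell] at h₁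
  have h₂ := gassoc_pair (idCells (.pair P (𝔼.U b))) (.single (𝔼.η b))
    (𝔼.rho P) (𝔼.idCell (𝔼.U b)) (𝔼.rho P)
  rw [gcomp_idCell, gcomp_ids] at h₂
  have h₃ := gassoc_pair (.single (𝔼.rho P)) (.nil (𝟙 b)) (𝔼.idCell P) (𝔼.η b) (𝔼.rho P)
  have h' : gcomp (CellPath.nil (𝟙 b)) (𝔼.η b) = 𝔼.η b := gcomp_ids (𝔼.η b)
  rw [rho_spec, gcomp_idCell, h'] at h₃
  have h₄ := h₃.symm.trans (gcomp_idCell (𝔼.rho P))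
  exact (h₁.trans (gcomp_ids (𝔼.rho P))).trans (h₂.trans h₄).symm

theorem lam_rho {a b : D} (P : 𝔼.Pro a b) :
    gcomp (.pair (𝔼.lam P) (𝔼.idCell (𝔼.U b))) (𝔼.rho P) =
      gcomp (.pair (𝔼.idCell (𝔼.U a)) (𝔼.rho P)) (𝔼.lam P) := by
  apply eta_cancel
  have h₁ := gassoc_pair (.pair (𝔼.η a) (𝔼.idCell P)) (.single (𝔼.idCell (𝔼.U b)))
    (𝔼.lam P) (𝔼.idCell (𝔼.U b)) (𝔼.rho P)
  rw [lam_spec, gcomp_idCell] at h₁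
  have h₂ := gassoc_pair (.single (𝔼.η a)) (idCells (.pair P (𝔼.U b)))
    (𝔼.idCell (𝔼.U a)) (𝔼.rho P) (𝔼.lam P)
  rw [gcomp_idCell, gcomp_ids, eta_lam] at h₂
  exact (h₁.trans (gcomp_ids (𝔼.rho P))).trans h₂.symm

/-- The trivial monoid on an object: its unit proarrow. -/
noncomputable def trivialMonoid (x : D) : 𝔼.VMonoid x where
  pro := 𝔼.U x
  e := 𝔼.η x
  m := 𝔼.lam (𝔼.U x)
  unit_mul := 𝔼.lam_spec _
  mul_unit := 𝔼.lam_unit x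
  mul_assoc := 𝔼.lam_lam _

/-- A proarrow regarded as a bimodule between trivial monoids. -/
noncomputable def trivialBimodule {x y : D} (P : 𝔼.Pro x y) :
    VBimodule (𝔼.trivialMonoid x) (𝔼.trivialMonoid y) where
  pro := P
  l := 𝔼.lam P
  r := 𝔼.rho P
  unit_l := 𝔼.lam_spec P
  mul_l := 𝔼.lam_lam P
  unit_r := 𝔼.rho_spec P
  mul_r := 𝔼.rho_rho P
  l_r := 𝔼.lam_rho P

/-- An embedding of a monoid into an object `x`: a homomorphism to the trivial monoid on `x`. -/
abbrev Embedding {c : D} (M : 𝔼.VMonoid c) (x : D) := VMonoidHom M (𝔼.trivialMonoid x)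

variable {𝔼}

/-- `φ` is an embedding of the bimodule `B` into the proarrow `P`, over the embeddings `F` and `G`
of monoids. -/
abbrev IsBimoduleEmbedding {c d x y : D} {M : 𝔼.VMonoid c} {N : 𝔼.VMonoid d}
    (F : 𝔼.Embedding M x) (G : 𝔼.Embedding N y) (B : VBimodule M N) (P : 𝔼.Pro x y)
    (φ : 𝔼.Cell (.single B.pro) F.hom G.hom P) : Prop :=
  IsBimoduleHom F G B (𝔼.trivialBimodule P) φ

/-- The embedding `G` is the composite of the embedding `F` with the vertical arrow `f`, that is,
the cell of `G` is the cell of `F` followed by the unit cell on `f`. -/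
structure Factors {c x y : D} {M : 𝔼.VMonoid c} (F : 𝔼.Embedding M x) (f : x ⟶ y)
    (G : 𝔼.Embedding M y) : Prop where
  hom_eq : F.hom ≫ f = G.hom
  cell_eq : 𝔼.comp (.single F.cell) (𝔼.unitCell f) hom_eq hom_eq = G.cell

/-- A collapse of a monoid: a universal embedding. -/
def IsCollapse {c x : D} {M : 𝔼.VMonoid c} (F : 𝔼.Embedding M x) : Prop :=
  ∀ {y : D} (G : 𝔼.Embedding M y), ∃! f : x ⟶ y, Factors F f G

/-- A collapse of a bimodule: a universal embedding over collapses `F` and `G` of its monoids. -/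
structure IsBimoduleCollapse {c d x y : D} {M : 𝔼.VMonoid c} {N : 𝔼.VMonoid d}
    (F : 𝔼.Embedding M x) (G : 𝔼.Embedding N y) (B : VBimodule M N) (P : 𝔼.Pro x y)
    (φ : 𝔼.Cell (.single B.pro) F.hom G.hom P) : Prop where
  left : IsCollapse F
  right : IsCollapse G
  embedding : IsBimoduleEmbedding F G B P φ
  universal : ∀ {x' y' : D} (F' : 𝔼.Embedding M x') (G' : 𝔼.Embedding N y') (Q : 𝔼.Pro x' y')
    (ψ : 𝔼.Cell (.single B.pro) F'.hom G'.hom Q), IsBimoduleEmbedding F' G' B Q ψ →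
    ∀ {f : x ⟶ x'} {g : y ⟶ y'} (hf : Factors F f F') (hg : Factors G g G'),
      ∃! χ : 𝔼.Cell (.single P) f g Q, 𝔼.comp (.single φ) χ hf.hom_eq hg.hom_eq = ψ

/-- A normal collapse: a collapse of `M` that is also a collapse of the unit bimodule of `M` into
the unit proarrow. -/
def IsNormalCollapse {c x : D} {M : 𝔼.VMonoid c} (F : 𝔼.Embedding M x) : Prop :=
  IsCollapse F ∧ IsBimoduleCollapse F F M.unitBimodule (𝔼.U x) F.cell

/-- The embedding `F` exhibits `M` as the kernel of the vertical arrow `F.hom`: the proarrow of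
`M` is the restriction of the unit proarrow along `F.hom` on both sides, and the monoid structure
is the one induced from the trivial monoid. -/
def IsKernelCell {c x : D} {M : 𝔼.VMonoid c} (F : 𝔼.Embedding M x) : Prop :=
  IsCartesian F.cell

/-- `M` is (isomorphic to) the kernel of the vertical arrow `f`. -/
def IsKernel {c x : D} (M : 𝔼.VMonoid c) (f : c ⟶ x) : Prop :=
  ∃ F : 𝔼.Embedding M x, F.hom = f ∧ IsKernelCell F

/-- A monoid is effective if it is the kernel of some vertical arrow. -/
def IsEffective {c : D} (M : 𝔼.VMonoid c) : Prop :=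
  ∃ (x : D) (f : c ⟶ x), IsKernel M f

variable (𝔼) in
/-- A vertical arrow is a regular cover if its kernel cell is a normal collapse. -/
def IsRegularCover {c d : D} (f : c ⟶ d) : Prop :=
  ∃ (M : 𝔼.VMonoid c) (F : 𝔼.Embedding M d), F.hom = f ∧ IsKernelCell F ∧ IsNormalCollapse F

variable (𝔼) in
/-- Regular virtual equipments. In the second axiom `φ` is any cartesian embedding
`B(g, f) → B`, where `f` and `g` are the vertical arrows of `F` and `G`. -/
structure IsRegular : Prop where
  exists_normalCollapse : ∀ {c : D} (M : 𝔼.VMonoid c), IsEffective M →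
    ∃ (x : D) (F : 𝔼.Embedding M x), IsNormalCollapse F
  isBimoduleCollapse : ∀ {c c' d d' : D} (B : 𝔼.Pro d d') {M : 𝔼.VMonoid c} {N : 𝔼.VMonoid c'}
    (F : 𝔼.Embedding M d) (G : 𝔼.Embedding N d'), IsKernelCell F → IsKernelCell G →
    𝔼.IsRegularCover F.hom → 𝔼.IsRegularCover G.hom →
    ∀ (A : VBimodule M N) (φ : 𝔼.Cell (.single A.pro) F.hom G.hom B),
      IsBimoduleEmbedding F G A B φ → IsCartesian φ → IsBimoduleCollapse F G A B φ

end VirtualEquipment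

/-! ### Internal relations -/

namespace InternalRel

variable {C : Type u} [Category.{v} C] [HasFiniteLimits C]

/-- Relations `R : a ⇸ b`, i.e. monomorphisms `R ↪ b × a`. -/
abbrev Relation (a b : C) := MonoOver (b ⨯ a)

/-- The leg of a relation `R : a ⇸ b` to its source `a`. -/
noncomputable abbrev src {a b : C} (R : Relation a b) : (R : C) ⟶ a := R.arrow ≫ prod.snd

/-- The leg of a relation `R : a ⇸ b` to its target `b`. -/
noncomputable abbrev tgt {a b : C} (R : Relation a b) : (R : C) ⟶ b := R.arrow ≫ prod.fst

/-- A span from `a` to `b`. -/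
structure Sp (a b : C) where
  apex : C
  l : apex ⟶ a
  r : apex ⟶ b

/-- The identity span. -/
abbrev Sp.id (a : C) : Sp a a := ⟨a, 𝟙 a, 𝟙 a⟩

/-- A relation as a span. -/
noncomputable abbrev Sp.ofRel {a b : C} (R : Relation a b) : Sp a b := ⟨R, src R, tgt R⟩

/-- The composite of spans, formed by pullback. -/
noncomputable abbrev Sp.comp {a b c : C} (S : Sp a b) (T : Sp b c) : Sp a c :=
  ⟨pullback S.r T.l, pullback.fst _ _ ≫ S.l, pullback.snd _ _ ≫ T.r⟩

/-- Morphisms of spans over `h` and `k`. -/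
@[ext] structure SpHom {a b c d : C} (S : Sp a b) (T : Sp c d) (h : a ⟶ c) (k : b ⟶ d) where
  map : S.apex ⟶ T.apex
  map_l : map ≫ T.l = S.l ≫ h
  map_r : map ≫ T.r = S.r ≫ k

/-- A cone with legs to `S` and `T`, agreeing over the middle object. -/
structure SpProj {a b c : C} (X : Sp a c) (S : Sp a b) (T : Sp b c) where
  p : X.apex ⟶ S.apex
  q : X.apex ⟶ T.apex
  p_l : p ≫ S.l = X.l
  q_r : q ≫ T.r = X.r
  mid : p ≫ S.r = q ≫ T.l

/-- The case of an identity span. -/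
def SpProj.id {a c : C} (T : Sp a c) : SpProj T (Sp.id a) T where
  p := T.l
  q := 𝟙 _
  p_l := by simp
  q_r := by simp
  mid := by simp

/-- Composing a cone with a span on the left. -/
noncomputable def SpProj.cons {z a b c : C} (R : Sp z a) {X : Sp a c} {S : Sp a b} {T : Sp b c}
    (π : SpProj X S T) : SpProj (R.comp X) (R.comp S) T where
  p := pullback.lift (pullback.fst _ _) (pullback.snd _ _ ≫ π.p)
    (by rw [Category.assoc, π.p_l, pullback.condition])
  q := pullback.snd _ _ ≫ π.q
  p_l := by simp [pullback.lift_fst_assoc]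
  q_r := by simp [π.q_r]
  mid := by simp [π.mid, pullback.lift_snd_assoc]

/-- The morphism into a composite of spans induced by morphisms into the two spans. -/
noncomputable def SpHom.pair {a b e c d i : C} {X : Sp a e} {S : Sp a b} {T : Sp b e}
    {S' : Sp c d} {T' : Sp d i} {h : a ⟶ c} {k : b ⟶ d} {l : e ⟶ i} (π : SpProj X S T)
    (m : SpHom S S' h k) (n : SpHom T T' k l) : SpHom X (S'.comp T') h l where
  map := pullback.lift (π.p ≫ m.map) (π.q ≫ n.map)
    (by rw [Category.assoc, Category.assoc, m.map_r, n.map_l, reassoc_of% π.mid])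
  map_l := by simp [pullback.lift_fst_assoc, m.map_l, reassoc_of% π.p_l]
  map_r := by simp [pullback.lift_snd_assoc, n.map_r, reassoc_of% π.q_r]

/-- The span composite `R₁ ×_{c₁} R₂ ×_{c₂} ⋯ ×_{cₙ₋₁} Rₙ` of a string of relations. For the empty
string on `a` it is `a` with two identity legs. -/
noncomputable def span : {a b : C} → ProPath (Relation (C := C)) a b → Sp a b
  | _, _, .nil a => Sp.id a
  | _, _, .cons R P => (Sp.ofRel R).comp (span P)

/-- Cells `R₁, …, Rₙ → S` with frames `f` and `g`: morphisms from the span composite of the `Rᵢ` to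
`S` that form a commutative square with `g × f`. -/
@[ext] structure RelCell {a b c d : C} (P : ProPath (Relation (C := C)) a b) (f : a ⟶ c)
    (g : b ⟶ d) (S : Relation c d) where
  map : (span P).apex ⟶ (S : C)
  w : map ≫ S.arrow = prod.lift (span P).r (span P).l ≫ prod.map g f

instance {a b c d : C} (P : ProPath (Relation (C := C)) a b) (f : a ⟶ c) (g : b ⟶ d)
    (S : Relation c d) : Subsingleton (RelCell P f g S) :=
  ⟨fun φ ψ => RelCell.ext ((cancel_mono S.arrow).1 (φ.w.trans ψ.w.symm))⟩

/-- A cell as a morphism of spans. -/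
noncomputable def RelCell.toSpHom {a b c d : C} {P : ProPath (Relation (C := C)) a b} {f : a ⟶ c}
    {g : b ⟶ d} {S : Relation c d} (φ : RelCell P f g S) : SpHom (span P) (Sp.ofRel S) f g where
  map := φ.map
  map_l := by simp [reassoc_of% φ.w, prod.lift_snd_assoc]
  map_r := by simp [reassoc_of% φ.w, prod.lift_fst_assoc]

variable (C) in
/-- Relations and their cells. -/
noncomputable def graph : VirtualDoubleGraph.{max u v, v} C where
  Pro := Relation
  Cell := RelCell

/-- The span composite of a concatenation projects to both span composites. -/
noncomputable def appendProj : {a b c : C} → (P : ProPath (Relation (C := C)) a b) →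
    (Q : ProPath (Relation (C := C)) b c) → SpProj (span (P.append Q)) (span P) (span Q)
  | _, _, _, .nil _, Q => SpProj.id (span Q)
  | _, _, _, .cons R P, Q => SpProj.cons (Sp.ofRel R) (appendProj P Q)

/-- The morphism of span composites induced by a string of cells. -/
noncomputable def cellsMap {a b c d : C} {Q : ProPath (Relation (C := C)) a b}
    {P : ProPath (Relation (C := C)) c d} {h : a ⟶ c} {k : b ⟶ d} :
    CellPath (graph C) Q P h k → SpHom (span Q) (span P) h k
  | .nil h => ⟨h, (Category.comp_id _).trans (Category.id_comp _).symm,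
      (Category.comp_id _).trans (Category.id_comp _).symm⟩
  | .cons (Q := Q₁) (Q' := Q₂) ψ Ψ hR =>
      SpHom.pair (hR ▸ appendProj Q₁ Q₂) (RelCell.toSpHom ψ) (cellsMap Ψ)

/-- The identity cell of a relation. -/
noncomputable def idRelCell {a b : C} (A : Relation a b) :
    RelCell (.single A) (𝟙 a) (𝟙 b) A where
  map := (pullback.fst (tgt A) (𝟙 b) :)
  w := by
    dsimp only [span]
    ext
    · simpa [prod.lift_fst] using pullback.condition (f := tgt A) (g := 𝟙 _)
    · simp [prod.lift_snd]

/-- The composite of a morphism of span composites with a cell. -/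
noncomputable def RelCell.precomp {a b c d x y : C} {Q : ProPath (Relation (C := C)) a b}
    {P : ProPath (Relation (C := C)) c d} {B : Relation x y} {h : a ⟶ c} {k : b ⟶ d} {f : c ⟶ x}
    {g : d ⟶ y} {f' : a ⟶ x} {g' : b ⟶ y} (m : SpHom (span Q) (span P) h k)
    (φ : RelCell P f g B) (hf : h ≫ f = f') (hg : k ≫ g = g') : RelCell Q f' g' B where
  map := m.map ≫ φ.map
  w := by
    subst hf hg
    rw [Category.assoc, φ.w]
    ext
    · simp [reassoc_of% m.map_r, prod.lift_fst]
    · simp [reassoc_of% m.map_l, prod.lift_snd]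

variable (C) in
/-- The virtual double category of internal relations. -/
noncomputable def Rel : VirtualDoubleCategory.{max u v, v} C where
  toVirtualDoubleGraph := graph C
  idCell A := idRelCell A
  comp Ψ φ hf hg := RelCell.precomp (cellsMap Ψ) φ hf hg
  ids_comp _ := Subsingleton.elim (α := RelCell _ _ _ _) _ _
  comp_id _ := Subsingleton.elim (α := RelCell _ _ _ _) _ _
  assoc _ _ _ _ _ _ _ _ _ _ _ := Subsingleton.elim (α := RelCell _ _ _ _) _ _

/-- The unit relation on `a`: the diagonal `a ↪ a × a`. -/
noncomputable def diagRel (a : C) : Relation a a := MonoOver.mk (diag a)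

theorem src_diagRel (a : C) : src (diagRel a) = tgt (diagRel a) :=
  (prod.lift_snd (𝟙 a) (𝟙 a)).trans (prod.lift_fst (𝟙 a) (𝟙 a)).symm

/-- The cell from the empty string to the diagonal. -/
noncomputable def diagCell (a : C) : RelCell (.nil a) (𝟙 a) (𝟙 a) (diagRel a) where
  map := 𝟙 a
  w := by
    refine (Category.id_comp (diag a)).trans ?_
    dsimp only [span]
    simp

/-- A diagonal can be removed from a string of relations. -/
noncomputable def removeDiag {b d : C} (S : ProPath (Relation (C := C)) b d) :
    {a : C} → (R : ProPath (Relation (C := C)) a b) →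
      SpHom (span (R.append (.cons (diagRel b) S))) (span (R.append S)) (𝟙 a) (𝟙 d)
  | _, .nil _ =>
    { map := (pullback.snd (tgt (diagRel b)) (span S).l :)
      map_l := by
        change pullback.snd (tgt (diagRel b)) (span S).l ≫ (span S).l =
          (pullback.fst (tgt (diagRel b)) (span S).l ≫ src (diagRel b)) ≫ 𝟙 _
        rw [← pullback.condition, src_diagRel, Category.comp_id]
      map_r := (Category.comp_id _).symm }
  | _, .cons A R =>
    { map := (pullback.lift (pullback.fst _ _) (pullback.snd _ _ ≫ (removeDiag S R).map) (by
          rw [Category.assoc, (removeDiag S R).map_l, Category.comp_id, pullback.condition]) :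
          ((Sp.ofRel A).comp (span (R.append (.cons (diagRel b) S)))).apex ⟶
            ((Sp.ofRel A).comp (span (R.append S))).apex)
      map_l := by
        dsimp only [ProPath.append, span]
        simp [pullback.lift_fst_assoc]
      map_r := by
        dsimp only [ProPath.append, span]
        simp [pullback.lift_snd_assoc, (removeDiag S R).map_r] }

theorem diagCell_isOpcartesian (a : C) : (Rel C).IsOpcartesian (diagCell a) := fun R S f g T =>
  ⟨fun _ _ _ => Subsingleton.elim (α := RelCell _ _ _ _) _ _, fun ψ =>
    ⟨RelCell.precomp (P := ProPath.append R S) (B := T) (removeDiag S R) ψ (Category.id_comp f)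
      (Category.id_comp g), Subsingleton.elim (α := RelCell _ _ _ _) _ _⟩⟩

/-- The restriction of a relation: its pullback along `g × f`. -/
noncomputable def restr {a b c d : C} (f : a ⟶ c) (g : b ⟶ d) (Q : Relation c d) :
    Relation a b :=
  MonoOver.mk (pullback.snd Q.arrow (prod.map g f))

/-- The projection of a restriction. -/
noncomputable def restrMap {a b c d : C} (f : a ⟶ c) (g : b ⟶ d) (Q : Relation c d) :
    (restr f g Q : C) ⟶ (Q : C) :=
  pullback.fst Q.arrow (prod.map g f)

theorem restrMap_w {a b c d : C} (f : a ⟶ c) (g : b ⟶ d) (Q : Relation c d) :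
    restrMap f g Q ≫ Q.arrow = (restr f g Q).arrow ≫ prod.map g f :=
  pullback.condition

/-- The restriction cell. -/
noncomputable def restrCell {a b c d : C} (f : a ⟶ c) (g : b ⟶ d) (Q : Relation c d) :
    RelCell (.single (restr f g Q)) f g Q where
  map := (idRelCell (restr f g Q)).map ≫ restrMap f g Q
  w := by
    have h := (idRelCell (restr f g Q)).w
    rw [prod.map_id_id, Category.comp_id] at h
    rw [← h, Category.assoc, Category.assoc, restrMap_w]

/-- The factorization of a cell through the restriction cell. -/
noncomputable def restrLift {x y a b c d : C} {f : a ⟶ c} {g : b ⟶ d} {Q : Relation c d}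
    {R : ProPath (Relation (C := C)) x y} {h : x ⟶ a} {k : y ⟶ b}
    (ψ : RelCell R (h ≫ f) (k ≫ g) Q) : RelCell R h k (restr f g Q) where
  map := (pullback.lift (f := Q.arrow) (g := prod.map g f) ψ.map (prod.lift (span R).r (span R).l ≫ prod.map k h)
    (by rw [ψ.w]; simp) :)
  w := pullback.lift_snd _ _ _

theorem rel_hasRestrictions : (Rel C).HasRestrictions := fun f g Q =>
  ⟨restr f g Q, restrCell f g Q, fun _ _ _ =>
    ⟨fun _ _ _ => Subsingleton.elim (α := RelCell _ _ _ _) _ _, fun ψ =>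
      ⟨restrLift ψ, Subsingleton.elim (α := RelCell _ _ _ _) _ _⟩⟩⟩

variable (C) in
/-- The virtual equipment of internal relations, with the diagonals as units. -/
noncomputable def RelEquipment : VirtualEquipment.{max u v, v} C where
  toVirtualDoubleCategory := Rel C
  U := diagRel
  η := diagCell
  η_opcartesian := diagCell_isOpcartesian
  hasRestrictions := rel_hasRestrictions

/-- The underlying relation `R ↪ a × a` of a monoid in `RelEquipment C`. -/
abbrev monRel {a : C} (M : (RelEquipment C).VMonoid a) : Relation a a := M.pro

end InternalRel

namespace InternalRel

section FiniteLimits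

variable {C : Type u} [Category.{v} C] [HasFiniteLimits C]

/-! ### Cells of relations -/

/-! A relation is a monomorphism, so a cell is determined by its source string, target and frames.
Every equation between cells holds automatically, and each universal property reduces to the
existence of a cell. What remains is a translation into limits and regular epimorphisms.

On the limit side, a cell with one source is cartesian exactly when its square over `prod.map g f`
is a pullback, and over a diagonal with equal frames `f` this says that the two legs form a kernel
pair of `f` (`isPullback_diagRel_iff`). An embedding of a monoid into an object is just a morphism
equalizing the two legs, so a collapse is just a coequalizer of them (`isCollapse_iff`).

On the other side, existence of cells descends along regular epimorphisms: in a regular category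
these are strong, hence lift against the monomorphism of the target relation. Three covers are used.
The image of a span composite in `b ⨯ a` is covered by that composite, and the cover stays a regular
epimorphism after pulling back along further relations on either side; so images are composites. A
coequalizer `q : a ⟶ x` covers the diagonal of `x`, and the unit of the monoid turns a cell out of
`M` into one out of `a`; so every collapse is normal. A restriction of `B` along `f` and `g` is the
base change of `B` along `g × f`, a regular epimorphism when `f` and `g` are; so restrictions along
regular covers are bimodule collapses. -/

instance {a b c d : C} (P : (RelEquipment C).Path a b) (f : a ⟶ c) (g : b ⟶ d)
    (S : (RelEquipment C).Pro c d) : Subsingleton ((RelEquipment C).Cell P f g S) :=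
  ⟨fun _ _ => Subsingleton.elim (α := RelCell _ _ _ _) _ _⟩

/-- A relation maps to the span composite of the string consisting of it alone. -/
noncomputable def toSpanSingle {a b : C} (R : Relation a b) :
    (R : C) ⟶ (span (.single R)).apex :=
  pullback.lift (f := tgt R) (g := 𝟙 b) (𝟙 _) (tgt R) (by simp)

theorem toSpanSingle_l {a b : C} (R : Relation a b) :
    toSpanSingle R ≫ (span (.single R)).l = src R := by
  change pullback.lift (f := tgt R) (g := 𝟙 b) (𝟙 _) (tgt R) _ ≫ pullback.fst _ _ ≫ src R = _
  rw [pullback.lift_fst_assoc, Category.id_comp]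

theorem toSpanSingle_r {a b : C} (R : Relation a b) :
    toSpanSingle R ≫ (span (.single R)).r = tgt R := by
  change pullback.lift (f := tgt R) (g := 𝟙 b) (𝟙 _) (tgt R) _ ≫ pullback.snd _ _ ≫ 𝟙 b = _
  rw [pullback.lift_snd_assoc, Category.comp_id]

theorem toSpanSingle_lift {a b : C} (R : Relation a b) :
    toSpanSingle R ≫ prod.lift (span (.single R)).r (span (.single R)).l = R.arrow := by
  ext
  · rw [Category.assoc, prod.lift_fst, toSpanSingle_r]
  · rw [Category.assoc, prod.lift_snd, toSpanSingle_l]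

/-- The morphism of relations underlying a cell with one source. -/
noncomputable def RelCell.hom {a b c d : C} {R : Relation a b} {f : a ⟶ c} {g : b ⟶ d}
    {S : Relation c d} (φ : RelCell (.single R) f g S) : (R : C) ⟶ (S : C) :=
  toSpanSingle R ≫ φ.map

theorem RelCell.hom_w {a b c d : C} {R : Relation a b} {f : a ⟶ c} {g : b ⟶ d}
    {S : Relation c d} (φ : RelCell (.single R) f g S) :
    φ.hom ≫ S.arrow = R.arrow ≫ prod.map g f := by
  rw [RelCell.hom, Category.assoc, φ.w, ← Category.assoc, toSpanSingle_lift]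

/-- The cell with one source given by a morphism of relations. -/
noncomputable def RelCell.ofHom {a b c d : C} {R : Relation a b} {f : a ⟶ c} {g : b ⟶ d}
    {S : Relation c d} (m : (R : C) ⟶ (S : C)) (w : m ≫ S.arrow = R.arrow ≫ prod.map g f) :
    RelCell (.single R) f g S where
  map := (idRelCell R).map ≫ m
  w := by
    have h := (idRelCell R).w
    rw [prod.map_id_id, Category.comp_id] at h
    rw [Category.assoc, w, ← Category.assoc, h]

/-- A cell with empty source is a morphism `x ⟶ S` lying over the frames. -/
noncomputable def RelCell.ofNil {x c d : C} {f : x ⟶ c} {g : x ⟶ d} {S : Relation c d}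
    (m : x ⟶ (S : C)) (w : m ≫ S.arrow = prod.lift g f) : RelCell (.nil x) f g S where
  map := m
  w := by
    refine w.trans ?_
    dsimp only [span]
    simp

theorem RelCell.nil_w {x c d : C} {f : x ⟶ c} {g : x ⟶ d} {S : Relation c d}
    (φ : RelCell (.nil x) f g S) :
    (show x ⟶ (S : C) from φ.map) ≫ S.arrow = prod.lift g f := by
  refine φ.w.trans ?_
  dsimp only [span]
  simp

theorem arrow_diagRel (x : C) {T : C} (m : T ⟶ (diagRel x : C)) :
    m ≫ (diagRel x).arrow ≫ prod.fst = m ≫ (diagRel x).arrow ≫ prod.snd := by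
  have := src_diagRel x
  dsimp only [src, tgt] at this
  rw [this]

/-- Both legs of a diagonal coincide, so a cell into it amounts to one equation between morphisms.
This direction extracts the equation; `RelCell.ofTgtEq` is the other. -/
theorem RelCell.tgt_comp_eq {a b x : C} {R : Relation a b} {f : a ⟶ x} {g : b ⟶ x}
    (φ : RelCell (.single R) f g (diagRel x)) : tgt R ≫ g = src R ≫ f := by
  have h := arrow_diagRel x φ.hom
  rw [reassoc_of% φ.hom_w, reassoc_of% φ.hom_w, prod.map_fst, prod.map_snd] at h
  simpa using h

/-- The cell from a single relation into the diagonal. -/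
noncomputable def RelCell.ofTgtEq {a b x : C} {R : Relation a b} {f : a ⟶ x} {g : b ⟶ x}
    (h : tgt R ≫ g = src R ≫ f) : RelCell (.single R) f g (diagRel x) :=
  .ofHom (S := diagRel x) (show (R : C) ⟶ x from src R ≫ f) (by
    change (src R ≫ f) ≫ diag x = _
    ext
    · simpa [prod.lift_fst] using h.symm
    · simp [prod.lift_snd])

/-! ### Cartesian cells -/

/-- Empty strings suffice to test the universal property: a cell from the empty string on `T` into
`P` is a morphism `T ⟶ P` over its two frames. Only the factorization through `P.arrow` has to be
produced; compatibility with `φ.hom` and uniqueness follow by cancelling the monomorphisms `Q.arrow`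
and `P.arrow`. -/
theorem isPullback_of_isCartesian {a b c d : C} {P : Relation a b} {Q : Relation c d} {f : a ⟶ c}
    {g : b ⟶ d} (φ : RelCell (.single P) f g Q) (hφ : (Rel C).IsCartesian φ) :
    IsPullback φ.hom P.arrow Q.arrow (prod.map g f) := by
  have key (s : PullbackCone Q.arrow (prod.map g f)) :
      ∃ l : s.pt ⟶ (P : C), l ≫ P.arrow = s.snd := by
    -- The frames are the two components of `s.snd`; the left frame is the second one, since a
    -- relation from `a` to `b` sits in `b ⨯ a`.
    obtain ⟨ψ, -⟩ := (hφ (.nil s.pt) (s.snd ≫ prod.snd) (s.snd ≫ prod.fst)).2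
      (RelCell.ofNil s.fst (by rw [s.condition]; ext <;> simp [prod.lift_fst, prod.lift_snd]))
    exact ⟨_, (RelCell.nil_w ψ).trans (by ext <;> simp [prod.lift_fst, prod.lift_snd])⟩
  choose l hl using key
  refine .of_isLimit' ⟨φ.hom_w⟩ (PullbackCone.IsLimit.mk _ l (fun s => ?_) hl fun s m _ hm => ?_)
  · rw [← cancel_mono Q.arrow, Category.assoc, φ.hom_w, reassoc_of% hl s, s.condition]
  · rw [← cancel_mono P.arrow, hl, hm]

theorem isCartesian_of_isPullback {a b c d : C} {P : Relation a b} {Q : Relation c d} {f : a ⟶ c}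
    {g : b ⟶ d} (φ : RelCell (.single P) f g Q)
    (hφ : IsPullback φ.hom P.arrow Q.arrow (prod.map g f)) : (Rel C).IsCartesian φ :=
  fun R h k => ⟨fun _ _ _ => Subsingleton.elim (α := RelCell _ _ _ _) _ _, fun ψ =>
    ⟨{ map := hφ.lift (RelCell.map ψ) (prod.lift (span R).r (span R).l ≫ prod.map k h)
          (by rw [RelCell.w ψ]; simp)
       w := hφ.lift_snd _ _ _ }, Subsingleton.elim (α := RelCell _ _ _ _) _ _⟩⟩

/-- A cone over the diagonal of `b` and `f × f` is the same as a pair of morphisms into `a` with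
equal composites with `f`, so both sides describe the same universal property. -/
theorem isPullback_diagRel_iff {a b : C} {R : Relation a a} {f : a ⟶ b}
    (φ : RelCell (.single R) f f (diagRel b)) :
    IsPullback φ.hom R.arrow (diagRel b).arrow (prod.map f f) ↔
      IsKernelPair f (tgt R) (src R) := by
  constructor <;> intro H
  · have key (s : PullbackCone f f) :
        ∃ l : s.pt ⟶ (R : C), l ≫ R.arrow = prod.lift s.fst s.snd :=
      -- The underlying object of `diagRel b` is `b` itself, so the common composite with `f` serves
      -- as the leg to the diagonal.
      ⟨H.lift (show s.pt ⟶ b from s.fst ≫ f) (prod.lift s.fst s.snd) (by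
        change (s.fst ≫ f) ≫ diag b = _
        ext
        · simp [prod.lift_fst]
        · simp [prod.lift_snd, s.condition]), H.lift_snd _ _ _⟩
    choose l hl using key
    refine .of_isLimit' ⟨φ.tgt_comp_eq⟩ (PullbackCone.IsLimit.mk _ l (fun s => ?_) (fun s => ?_)
      fun s m h₁ h₂ => ?_)
    · rw [reassoc_of% hl s, prod.lift_fst]
    · rw [reassoc_of% hl s, prod.lift_snd]
    · rw [← cancel_mono R.arrow, hl]
      ext
      · rw [Category.assoc, h₁, prod.lift_fst]
      · rw [Category.assoc, h₂, prod.lift_snd]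
  · have key (s : PullbackCone (diagRel b).arrow (prod.map f f)) :
        ∃ l : s.pt ⟶ (R : C), l ≫ R.arrow = s.snd := by
      have h : (s.snd ≫ prod.fst) ≫ f = (s.snd ≫ prod.snd) ≫ f := by
        have h := arrow_diagRel b s.fst
        rw [reassoc_of% s.condition, reassoc_of% s.condition, prod.map_fst, prod.map_snd] at h
        simpa using h
      refine ⟨H.lift _ _ h, ?_⟩
      ext
      · rw [Category.assoc, H.lift_fst]
      · rw [Category.assoc, H.lift_snd]
    choose l hl using key
    refine .of_isLimit' ⟨φ.hom_w⟩ (PullbackCone.IsLimit.mk _ l (fun s => ?_) hl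
      fun s m _ hm => ?_)
    · rw [← cancel_mono (diagRel b).arrow, Category.assoc, φ.hom_w, reassoc_of% hl s, s.condition]
    · rw [← cancel_mono R.arrow, hl, hm]

/-! ### Strings of relations -/

/-- Pasting: the square from `R.comp X` to `R.comp S` over `X` and `S` is a pullback because, pasted
with the pullback defining `R.comp S`, it gives the one defining `R.comp X`. It is then pasted with
`h`. -/
theorem SpProj.isPullback_cons {z a b c : C} (R : Sp z a) {X : Sp a c} {S : Sp a b} {T : Sp b c}
    (π : SpProj X S T) (h : IsPullback π.p π.q S.r T.l) :
    IsPullback (π.cons R).p (π.cons R).q (R.comp S).r T.l := by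
  refine (IsPullback.paste_horiz (IsPullback.flip ?_) h.flip).flip
  refine IsPullback.of_right (h₁₂ := pullback.fst R.r S.l) (v₁₃ := R.r) (h₂₂ := S.l) ?_ ?_
    (IsPullback.of_hasPullback R.r S.l)
  · have := IsPullback.of_hasPullback R.r X.l
    dsimp only [SpProj.cons]
    rwa [pullback.lift_fst, π.p_l]
  · dsimp only [SpProj.cons]
    rw [pullback.lift_snd]

/-- Associativity of span composition: the iterated pullback of a concatenated string is the
pullback of those of its two halves. -/
theorem isPullback_appendProj {a b c : C} (P : ProPath (Relation (C := C)) a b)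
    (Q : ProPath (Relation (C := C)) b c) :
    IsPullback (appendProj P Q).p (appendProj P Q).q (span P).r (span Q).l := by
  induction P with
  | nil a => exact (IsPullback.id_horiz (span Q).l).flip
  | cons R P ih => exact SpProj.isPullback_cons (Sp.ofRel R) _ (ih Q)

end FiniteLimits

section Regular

variable {C : Type u} [Category.{v} C] [Regular C]

/-! ### Regular epimorphisms -/

/-- In a regular category the regular epimorphisms are the strong ones, and strong epimorphisms
compose. -/
theorem isRegularEpi_comp {X Y Z : C} (f : X ⟶ Y) (g : Y ⟶ Z) [IsRegularEpi f] [IsRegularEpi g] :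
    IsRegularEpi (f ≫ g) :=
  have := strongEpi_comp f g
  inferInstance

theorem isRegularEpi_of_isPullback {X Y Z W : C} {f : X ⟶ Y} {f' : Z ⟶ W} {g' : Z ⟶ X}
    {g : W ⟶ Y} (h : IsPullback g' f' f g) [IsRegularEpi f] : IsRegularEpi f' :=
  Regular.regularEpiIsStableUnderBaseChange.of_isPullback h ‹IsRegularEpi f›

/-- The product map factors as `f × 𝟙` followed by `𝟙 × g`, which are base changes of `f` and `g`
along product projections. -/
theorem isRegularEpi_prodMap {X Y X' Y' : C} (f : X ⟶ Y) (g : X' ⟶ Y') [IsRegularEpi f]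
    [IsRegularEpi g] : IsRegularEpi (prod.map f g) := by
  have h₁ : IsRegularEpi (prod.map f (𝟙 X')) := by
    refine isRegularEpi_of_isPullback (f := f) (g := prod.fst) (g' := prod.fst) ?_
    exact IsPullback.of_prod_fst_with_id f X'
  have h₂ : IsRegularEpi (prod.map (𝟙 Y) g) := by
    refine isRegularEpi_of_isPullback (f := g) (g := prod.snd) (g' := prod.snd) ?_
    refine .of_isLimit' ⟨by simp⟩ (PullbackCone.IsLimit.mk _
      (fun s => prod.lift (s.snd ≫ prod.fst) s.fst) (fun s => by simp [prod.lift_snd])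
      (fun s => ?_) fun s m h₁ h₂ => ?_)
    · ext
      · simp [prod.lift_fst]
      · simp [prod.lift_snd, s.condition]
    · ext
      · simp [prod.lift_fst, ← h₂]
      · simp [prod.lift_snd, ← h₁]
  have := isRegularEpi_comp (prod.map f (𝟙 X')) (prod.map (𝟙 Y) g)
  simpa using this

/-- Cells can be constructed on a regular epimorphic cover of the source. -/
theorem RelCell.nonempty_of_isRegularEpi {a b c d X : C} {P : ProPath (Relation (C := C)) a b}
    {f : a ⟶ c} {g : b ⟶ d} {S : Relation c d} (e : X ⟶ (span P).apex) [IsRegularEpi e]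
    (m : X ⟶ (S : C))
    (w : m ≫ S.arrow = e ≫ prod.lift (span P).r (span P).l ≫ prod.map g f) :
    Nonempty (RelCell P f g S) :=
  -- The lift exists because the regular epimorphism `e` is strong and `S.arrow` is a monomorphism.
  have sq : CommSq m e S.arrow (prod.lift (span P).r (span P).l ≫ prod.map g f) := ⟨w⟩
  ⟨⟨sq.lift, sq.fac_right⟩⟩

/-- Descent when the cover is itself a cell between relations; it is applied to a restriction cell.
-/
theorem RelCell.nonempty_of_isRegularEpi_hom {a b a' b' c d : C} {R : Relation a b}
    {R' : Relation a' b'} {p : a ⟶ a'} {q : b ⟶ b'} (φ : RelCell (.single R) p q R')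
    [IsRegularEpi φ.hom] {f : a' ⟶ c} {g : b' ⟶ d} {S : Relation c d}
    {p' : a ⟶ c} {q' : b ⟶ d} (hp : p ≫ f = p') (hq : q ≫ g = q')
    (ψ : RelCell (.single R) p' q' S) : Nonempty (RelCell (.single R') f g S) :=
  have sq : CommSq ψ.hom φ.hom S.arrow (R'.arrow ≫ prod.map g f) :=
    ⟨by rw [ψ.hom_w, reassoc_of% φ.hom_w, prod.map_map, hp, hq]⟩
  ⟨.ofHom sq.lift sq.fac_right⟩

/-- Descent along `q`, seen as a cover of the diagonal of `x`, whose underlying object is `x`. This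
is what makes collapses normal. -/
theorem RelCell.nonempty_diagRel {a x c d : C} (q : a ⟶ x) [IsRegularEpi q] {f : x ⟶ c}
    {g : x ⟶ d} {S : Relation c d} (ψ : RelCell (.nil a) (q ≫ f) (q ≫ g) S) :
    Nonempty (RelCell (.single (diagRel x)) f g S) :=
  have sq : CommSq (show a ⟶ (S : C) from ψ.map) q S.arrow (diag x ≫ prod.map g f) :=
    ⟨by rw [ψ.nil_w]; ext <;> simp [prod.lift_fst, prod.lift_snd]⟩
  ⟨.ofHom (R := diagRel x) sq.lift sq.fac_right⟩

/-! ### Composites -/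

/-- The induced map between the two pullbacks is the base change of `n.map` along the projection
`R.comp Y ⟶ Y`. -/
theorem exists_spHom_comp_right {a b c : C} (R : Sp a b) {X Y : Sp b c}
    (n : SpHom X Y (𝟙 b) (𝟙 c)) [IsRegularEpi n.map] :
    ∃ k : SpHom (R.comp X) (R.comp Y) (𝟙 a) (𝟙 c), IsRegularEpi k.map := by
  have hl : n.map ≫ Y.l = X.l := n.map_l.trans (Category.comp_id _)
  have w : pullback.fst R.r X.l ≫ R.r = (pullback.snd R.r X.l ≫ n.map) ≫ Y.l := by
    rw [Category.assoc, hl, pullback.condition]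
  refine ⟨⟨pullback.lift (pullback.fst _ _) (pullback.snd _ _ ≫ n.map) w, ?_, ?_⟩, ?_⟩
  · simp [pullback.lift_fst_assoc]
  · simp [pullback.lift_snd_assoc, n.map_r]
  · refine isRegularEpi_of_isPullback (f := n.map) (g := pullback.snd R.r Y.l)
      (g' := pullback.snd R.r X.l) (IsPullback.flip (IsPullback.of_right
        (h₁₂ := pullback.fst R.r Y.l) (v₁₃ := R.r) (h₂₂ := Y.l) ?_ ?_ (IsPullback.of_hasPullback R.r Y.l)))
    · rw [pullback.lift_fst, hl]
      exact IsPullback.of_hasPullback R.r X.l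
    · rw [pullback.lift_snd]

/-- The induced map is the base change of `m.map` along `S'.comp T ⟶ S'`. The source is any pullback
`X` of `S` and `T`, because the span of a concatenated string is such a pullback but is not
literally `S.comp T`. -/
theorem exists_spHom_comp_left {a b c : C} {X : Sp a c} {S S' : Sp a b} {T : Sp b c}
    (π : SpProj X S T) (hπ : IsPullback π.p π.q S.r T.l) (m : SpHom S S' (𝟙 a) (𝟙 b))
    [IsRegularEpi m.map] :
    ∃ k : SpHom X (S'.comp T) (𝟙 a) (𝟙 c), IsRegularEpi k.map := by
  have hr : m.map ≫ S'.r = S.r := m.map_r.trans (Category.comp_id _)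
  refine ⟨SpHom.pair π m ⟨𝟙 _, by simp, by simp⟩, ?_⟩
  refine isRegularEpi_of_isPullback (f := m.map) (g := pullback.fst S'.r T.l) (g' := π.p)
    (IsPullback.flip (IsPullback.of_right (h₁₂ := pullback.snd S'.r T.l)
      (v₁₃ := T.l) (h₂₂ := S'.r) ?_ ?_ (IsPullback.of_hasPullback S'.r T.l).flip))
  · dsimp only [SpHom.pair]
    rw [pullback.lift_snd, hr, Category.comp_id]
    exact hπ.flip
  · dsimp only [SpHom.pair]
    rw [pullback.lift_fst]

/-- A cover of `Q` by a string remains a cover inside any longer string: `S` is attached by one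
pullback, then the members of `R` one at a time. -/
theorem exists_spHom_append {c d b : C} {P : ProPath (Relation (C := C)) c d} {Q : Relation c d}
    (m : SpHom (span P) (Sp.ofRel Q) (𝟙 c) (𝟙 d)) [IsRegularEpi m.map]
    (S : ProPath (Relation (C := C)) d b) {a : C} (R : ProPath (Relation (C := C)) a c) :
    ∃ n : SpHom (span (R.append (P.append S))) (span (R.append (.cons Q S))) (𝟙 a) (𝟙 b),
      IsRegularEpi n.map := by
  induction R with
  | nil a => exact exists_spHom_comp_left (appendProj P S) (isPullback_appendProj P S) m
  | cons A R ih =>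
    obtain ⟨n, hn⟩ := ih m
    exact exists_spHom_comp_right (Sp.ofRel A) n

theorem RelCell.nonempty_append {c d a b x y : C} {P : ProPath (Relation (C := C)) c d}
    {Q : Relation c d} (φ : RelCell P (𝟙 c) (𝟙 d) Q) [hφ : IsRegularEpi φ.map]
    {R : ProPath (Relation (C := C)) a c} {S : ProPath (Relation (C := C)) d b} {f : a ⟶ x}
    {g : b ⟶ y} {T : Relation x y} (ψ : RelCell (R.append (P.append S)) f g T) :
    Nonempty (RelCell (R.append (.cons Q S)) f g T) := by
  have : IsRegularEpi φ.toSpHom.map := hφ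
  obtain ⟨n, hn⟩ := exists_spHom_append φ.toSpHom S R
  refine RelCell.nonempty_of_isRegularEpi n.map ψ.map ?_
  rw [ψ.w]
  ext
  · simp [prod.lift_fst, reassoc_of% n.map_r]
  · simp [prod.lift_snd, reassoc_of% n.map_l]

theorem relEquipment_hasComposites : (RelEquipment C).HasComposites := by
  intro a b P
  -- The composite relation is the image of the span composite in `b ⨯ a`.
  let F := Regular.strongEpiMonoFactorisation (prod.lift (span P).r (span P).l)
  let Q : Relation a b := MonoOver.mk F.m
  let φ : RelCell P (𝟙 a) (𝟙 b) Q := ⟨F.e, F.fac.trans (by simp)⟩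
  have : IsRegularEpi φ.map := inferInstanceAs (IsRegularEpi F.e)
  refine ⟨Q, φ, fun R S f g T =>
    ⟨fun _ _ _ => Subsingleton.elim (α := RelCell _ _ _ _) _ _, fun ψ => ?_⟩⟩
  obtain ⟨χ⟩ := RelCell.nonempty_append φ ψ
  exact ⟨χ, Subsingleton.elim (α := RelCell _ _ _ _) _ _⟩

/-! ### Kernels -/

theorem isKernel_iff {a b : C} (M : (RelEquipment C).VMonoid a) (f : a ⟶ b) :
    VirtualEquipment.IsKernel M f ↔ IsKernelPair f (tgt (monRel M)) (src (monRel M)) := by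
  constructor
  · rintro ⟨F, rfl, hF⟩
    exact (isPullback_diagRel_iff (F.cell : RelCell _ _ _ _)).1 (isPullback_of_isCartesian _ hF)
  · intro h
    have φ : RelCell (.single (monRel M)) f f (diagRel b) := .ofTgtEq h.w
    exact ⟨⟨f, φ, Subsingleton.elim _ _, Subsingleton.elim _ _⟩, rfl,
      isCartesian_of_isPullback _ ((isPullback_diagRel_iff φ).2 h)⟩

theorem exists_isKernel {a b : C} (f : a ⟶ b) :
    ∃ M : (RelEquipment C).VMonoid a, VirtualEquipment.IsKernel M f := by
  obtain ⟨P, φ, hφ⟩ := (RelEquipment C).hasRestrictions f f ((RelEquipment C).U b)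
  -- Unit and multiplication are induced through the cartesian cell `φ` from those of the trivial
  -- monoid on `b`.
  have e := ((hφ (.nil a) (𝟙 a) (𝟙 a)).2 ((RelEquipment C).comp (.nil f) ((RelEquipment C).η b)
    (by simp) (by simp))).choose
  have m := ((hφ (.pair P P) (𝟙 a) (𝟙 a)).2 ((RelEquipment C).comp (.pair φ φ)
    ((RelEquipment C).lam _) (by simp) (by simp))).choose
  exact ⟨⟨P, e, m, Subsingleton.elim _ _, Subsingleton.elim _ _, Subsingleton.elim _ _⟩,
    ⟨f, φ, Subsingleton.elim _ _, Subsingleton.elim _ _⟩, rfl, hφ⟩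

/-! ### Collapses -/

theorem embedding_w {a x : C} {M : (RelEquipment C).VMonoid a}
    (F : (RelEquipment C).Embedding M x) :
    tgt (monRel M) ≫ F.hom = src (monRel M) ≫ F.hom :=
  RelCell.tgt_comp_eq (R := monRel M) F.cell

/-- The embedding given by a morphism that coequalizes the two projections of a monoid. -/
noncomputable def embeddingOfEq {a x : C} {M : (RelEquipment C).VMonoid a} (q : a ⟶ x)
    (hq : tgt (monRel M) ≫ q = src (monRel M) ≫ q) : (RelEquipment C).Embedding M x where
  hom := q
  cell := RelCell.ofTgtEq (R := monRel M) hq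
  unit := Subsingleton.elim _ _
  mul := Subsingleton.elim _ _

/-- Embeddings into `y` correspond to morphisms `a ⟶ y` equalizing the two legs, and factoring one
through `F` is a condition on morphisms alone. -/
theorem isCollapse_iff {a x : C} {M : (RelEquipment C).VMonoid a}
    (F : (RelEquipment C).Embedding M x) :
    VirtualEquipment.IsCollapse F ↔ Nonempty (IsColimit (Cofork.ofπ F.hom (embedding_w F))) := by
  constructor
  · intro h
    choose f hf using @h
    refine ⟨Cofork.IsColimit.mk _ (fun s => f (embeddingOfEq s.π s.condition))
      (fun s => (hf _).1.hom_eq) fun s m hm => (hf _).2 m ⟨hm, Subsingleton.elim _ _⟩⟩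
  · rintro ⟨h⟩ y G
    obtain ⟨f, hf⟩ := Cofork.IsColimit.desc' h G.hom (embedding_w G)
    exact ⟨f, ⟨hf, Subsingleton.elim _ _⟩, fun g hg =>
      Cofork.IsColimit.hom_ext h (hg.hom_eq.trans hf.symm)⟩

theorem isNormalCollapse_of_isCollapse {a x : C} {M : (RelEquipment C).VMonoid a}
    {F : (RelEquipment C).Embedding M x} (hF : VirtualEquipment.IsCollapse F) :
    VirtualEquipment.IsNormalCollapse F := by
  refine ⟨hF, hF, hF, ⟨Subsingleton.elim _ _, Subsingleton.elim _ _⟩, ?_⟩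
  intro x' y' F' G' Q ψ _ f g hf hg
  obtain ⟨hc⟩ := (isCollapse_iff F).1 hF
  have : IsRegularEpi F.hom := ⟨⟨⟨_, _, _, embedding_w F, hc⟩⟩⟩
  -- Precomposing `ψ` with the unit of `M` gives a cell from the empty string on `a`, whose frames
  -- factor through the coequalizer `F.hom`; it therefore descends to the diagonal of `x`.
  obtain ⟨χ⟩ := RelCell.nonempty_diagRel F.hom (f := f) (g := g) (S := Q)
    ((RelEquipment C).comp (.single M.e) ψ ((Category.id_comp _).trans hf.hom_eq.symm)
      ((Category.id_comp _).trans hg.hom_eq.symm))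
  exact ⟨χ, Subsingleton.elim _ _, fun _ _ => Subsingleton.elim _ _⟩

theorem isRegularEpi_of_isRegularCover {a x : C} {f : a ⟶ x}
    (hf : (RelEquipment C).IsRegularCover f) : IsRegularEpi f := by
  obtain ⟨M, F, rfl, -, hF, -⟩ := hf
  obtain ⟨hc⟩ := (isCollapse_iff F).1 hF
  exact ⟨⟨⟨_, _, _, embedding_w F, hc⟩⟩⟩

/-- A regular epimorphism is the coequalizer of its kernel pair, which is what the legs of `M` are.
-/
theorem isCollapse_of_isKernelCell {a x : C} {M : (RelEquipment C).VMonoid a}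
    {F : (RelEquipment C).Embedding M x} (hF : VirtualEquipment.IsKernelCell F)
    [IsRegularEpi F.hom] : VirtualEquipment.IsCollapse F :=
  (isCollapse_iff F).2 ⟨((isKernel_iff M F.hom).1 ⟨F, rfl, hF⟩).toCoequalizer'⟩

theorem relEquipment_isRegular : (RelEquipment C).IsRegular where
  exists_normalCollapse := by
    rintro c M ⟨x, f, h⟩
    have := Regular.hasCoequalizer_of_isKernelPair ((isKernel_iff M f).1 h)
    exact ⟨_, embeddingOfEq (coequalizer.π _ _) (coequalizer.condition _ _),
      isNormalCollapse_of_isCollapse ((isCollapse_iff _).2 ⟨coequalizerIsCoequalizer _ _⟩)⟩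
  isBimoduleCollapse := by
    intro c c' d d' B M N F G hF hG hF' hG' A φ hφ hφ'
    -- The monoid witnessing a regular cover need not be `M` or `N`. Only the regular epimorphism is
    -- kept, and the collapses of `M` and `N` are recovered from their being kernel pairs.
    have := isRegularEpi_of_isRegularCover hF'
    have := isRegularEpi_of_isRegularCover hG'
    have := isRegularEpi_prodMap G.hom F.hom
    -- The morphism underlying the cartesian cell is the base change of `G.hom × F.hom` along
    -- `B.arrow`.
    have := isRegularEpi_of_isPullback (isPullback_of_isCartesian (P := A.pro) φ hφ').flip
    refine ⟨isCollapse_of_isKernelCell hF, isCollapse_of_isKernelCell hG, hφ, ?_⟩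
    intro x' y' F' G' Q ψ _ f g hf hg
    obtain ⟨χ⟩ := RelCell.nonempty_of_isRegularEpi_hom (R := A.pro) φ hf.hom_eq hg.hom_eq ψ
    exact ⟨χ, Subsingleton.elim _ _, fun _ _ => Subsingleton.elim _ _⟩

end Regular

end InternalRel

theorem mainTheorem5 {C : Type u} [Category.{v} C] [Regular C] :
    -- the virtual equipment of relations has all composites, so it is an equipment, and is regular
    (InternalRel.RelEquipment C).HasComposites ∧
    (InternalRel.RelEquipment C).IsRegular ∧
    -- every morphism has a kernel
    (∀ {a b : C} (f : a ⟶ b),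
      ∃ M : (InternalRel.RelEquipment C).VMonoid a, VirtualEquipment.IsKernel M f) ∧
    -- a monoid is the kernel of `f` if and only if it is the kernel pair of `f`
    (∀ {a b : C} (M : (InternalRel.RelEquipment C).VMonoid a) (f : a ⟶ b),
      VirtualEquipment.IsKernel M f ↔
        IsKernelPair f (InternalRel.tgt (InternalRel.monRel M))
          (InternalRel.src (InternalRel.monRel M))) ∧
    -- a coequalizer of an effective monoid is a normal collapse
    (∀ {a x : C} (M : (InternalRel.RelEquipment C).VMonoid a), VirtualEquipment.IsEffective M →
      ∀ (q : a ⟶ x)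
        (hq : InternalRel.tgt (InternalRel.monRel M) ≫ q =
          InternalRel.src (InternalRel.monRel M) ≫ q),
        Nonempty (IsColimit (Cofork.ofπ q hq)) →
          ∃ F : (InternalRel.RelEquipment C).Embedding M x,
            F.hom = q ∧ VirtualEquipment.IsNormalCollapse F) := by
  refine ⟨InternalRel.relEquipment_hasComposites, InternalRel.relEquipment_isRegular,
    InternalRel.exists_isKernel, InternalRel.isKernel_iff, ?_⟩
  intro a x M _ q hq h
  exact ⟨InternalRel.embeddingOfEq q hq, rfl,
    InternalRel.isNormalCollapse_of_isCollapse ((InternalRel.isCollapse_iff _).2 h)⟩
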